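/- Let $\mathbb{BC}=\{z_1+z_2\mathbf{i_2} : z_1,z_2\in\mathbb{C}(\mathbf{i_1})\}$ be the commutative ring of bicomplex numbers, where $\mathbb{C}(\mathbf{i_1})$ is the field of complex numbers with imaginary unit $\mathbf{i_1}$ and $\mathbf{i_2}^2=-1$, with norm $\|z_1+z_2\mathbf{i_2}\|=\sqrt{|z_1|^2+|z_2|^2}$. Put $\mathbf{j}=\mathbf{i_1}\mathbf{i_2}$, $\mathbf{e_1}=\frac{1+\mathbf{j}}{2}$, $\mathbf{e_2}=\frac{1-\mathbf{j}}{2}$, and for $X_1,X_2\subseteq\mathbb{C}(\mathbf{i_1})$ write $X_1\times_e X_2=\{w_1\mathbf{e_1}+w_2\mathbf{e_2} : w_1\in X_1,\ w_2\in X_2\}$. For $c=c_1+c_2\mathbf{i_2}\in\mathbb{BC}$ let $P_c(w)=w^2+c$, let $P_c^{k}$ be its $k$-th iterate and $P_c^{-k}(w)=\{v\in\mathbb{BC} : P_c^k(v)=w\}$, let $\mathcal{K}_{2,c}$ be the set of all $w\in\mathbb{BC}$ whose forward orbit $\{P_c^n(w)\}_{n\ge 0}$ is bounded, and let $\mathcal{J}_{2,c}=\partial\mathcal{K}_{2,c}$.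 A complex dendrite is a compact, pathwise connected (in particular nonempty), locally connected, nowhere dense subset of the complex plane whose complement is connected. A bicomplex dendrite is a set of the form $X_1\times_e X_2$ with $X_1$ and $X_2$ complex dendrites. (Since $\mathcal{K}_{2,c}=\mathcal{K}_{c_1-c_2\mathbf{i_1}}\times_e\mathcal{K}_{c_1+c_2\mathbf{i_1}}$, where $\mathcal{K}_a$ is the filled-in Julia set of the complex map $z\mapsto z^2+a$, the set $\mathcal{K}_{2,c}$ is a bicomplex dendrite exactly when both $\mathcal{K}_{c_1-c_2\mathbf{i_1}}$ and $\mathcal{K}_{c_1+c_2\mathbf{i_1}}$ are complex dendrites.) **Corollary.** Let $c\in\mathbb{BC}$ be such that $\mathcal{K}_{2,c}$ is a bicomplex dendrite, and let $w_1$ be a fixed point of $P_c$ with $w_1\in\mathcal{J}_{2,c}$. Then the set $\bigcup_{k=1}^{\infty}P_c^{-k}(w_1)$ is dense in $\mathcal{J}_{2,c}$; that is, it is contained in $\mathcal{J}_{2,c}$ and its closure contains $\mathcal{J}_{2,c}$. -/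

import Mathlib

noncomputable section

/-- The ring of bicomplex numbers `z₁ + z₂ i₂` with `z₁, z₂ ∈ ℂ(i₁)` and `i₂² = -1`:
`w.re` is `z₁`, `w.im` is `z₂`, and the unit `i₁` is `Complex.I`. -/
abbrev Bicomplex : Type := QuadraticAlgebra ℂ (-1) 0

namespace Bicomplex

/-- The pair `(z₁, z₂) ∈ ℂ²` of complex coordinates of `z₁ + z₂ i₂`, where `ℂ²` carries its
Euclidean norm. -/
def toC2 : Bicomplex →+ WithLp 2 (ℂ × ℂ) where
  toFun w := WithLp.toLp 2 (w.re, w.im)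
  map_zero' := rfl
  map_add' _ _ := rfl

theorem toC2_injective : Function.Injective toC2 := by
  intro a b h
  have h' : (a.re, a.im) = (b.re, b.im) := congrArg WithLp.ofLp h
  exact QuadraticAlgebra.ext (congrArg Prod.fst h') (congrArg Prod.snd h')

/-- The real modulus, with the metric, topology and bornology that it induces. -/
instance instNormedAddCommGroup : NormedAddCommGroup Bicomplex :=
  NormedAddCommGroup.induced Bicomplex (WithLp 2 (ℂ × ℂ)) toC2 toC2_injective

theorem norm_eq (w : Bicomplex) : ‖w‖ = Real.sqrt (‖w.re‖ ^ 2 + ‖w.im‖ ^ 2) :=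
  WithLp.prod_norm_eq_of_L2 (toC2 w)

/-- The bicomplex unit `i₂`. -/
def i₂ : Bicomplex := ⟨0, 1⟩

/-- The hyperbolic unit `j = i₁ i₂`. -/
def j : Bicomplex := Complex.I • i₂

/-- The idempotent `e₁ = (1 + j) / 2`. -/
def e₁ : Bicomplex := (1 / 2 : ℂ) • (1 + j)

/-- The idempotent `e₂ = (1 - j) / 2`. -/
def e₂ : Bicomplex := (1 / 2 : ℂ) • (1 - j)

/-- The bicomplex cartesian set `X₁ ×ₑ X₂`. -/
def cartesian (X₁ X₂ : Set ℂ) : Set Bicomplex :=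
  {w | ∃ w₁ ∈ X₁, ∃ w₂ ∈ X₂, w = w₁ • e₁ + w₂ • e₂}

/-- The polynomial map `P_c(w) = w² + c`. -/
def quadMap (c w : Bicomplex) : Bicomplex := w ^ 2 + c

/-- The bicomplex filled-in Julia set: the points whose forward orbit under `P_c` is bounded. -/
def filledJulia (c : Bicomplex) : Set Bicomplex :=
  {w | Bornology.IsBounded (Set.range fun n : ℕ => (quadMap c)^[n] w)}

/-- The bicomplex Julia set: the boundary of the filled-in Julia set. -/
def julia (c : Bicomplex) : Set Bicomplex := frontier (filledJulia c)

/-- The inverse iterate `P_c^{-k}(w)`, the set of all points that `P_c^k` maps to `w`. -/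
def inverseIterate (c : Bicomplex) (k : ℕ) (w : Bicomplex) : Set Bicomplex :=
  {v | (quadMap c)^[k] v = w}

end Bicomplex

/-- A complex dendrite: a compact, pathwise connected (in particular nonempty), locally connected,
nowhere dense subset of the plane that does not separate the plane. -/
structure IsComplexDendrite (X : Set ℂ) : Prop where
  isCompact : IsCompact X
  isPathConnected : IsPathConnected X
  locallyConnected : LocallyConnectedSpace X
  isNowhereDense : IsNowhereDense X
  isConnected_compl : IsConnected Xᶜ

/-- A bicomplex dendrite: a bicomplex cartesian set whose two components are complex dendrites. -/
def IsBicomplexDendrite (X : Set Bicomplex) : Prop :=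
  ∃ X₁ X₂ : Set ℂ, IsComplexDendrite X₁ ∧ IsComplexDendrite X₂ ∧ X = Bicomplex.cartesian X₁ X₂

end

/-!
In idempotent components, `P_c` acts as a pair of quadratic polynomials `Q(z) = z ^ 2 + a` of the
complex plane, and its filled-in Julia set is the product of the two planar ones
(`Bicomplex.mem_filledJulia_iff`). If it is a bicomplex dendrite, it is compact and has empty
interior, so it coincides with its boundary, the Julia set (`Bicomplex.julia_eq_filledJulia`). As
the iterated preimages of a fixed point increase with the number of iterations, their union is the
product of the two planar backward orbits, and it suffices to show that a planar
filled-in Julia set `K` with dense complement lies in the closure of every backward orbit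
(`complexFilledJulia_subset_closure_preimages`).

The planar statement is usually deduced from Montel's theorem on omitted values. The argument here
is potential-theoretic. If a disc about a point of `K` misses the backward orbit of `p`, then
`u n = 2 ^ (-n) * log ‖Qⁿ - p‖` is harmonic on that disc. These functions are bounded above, they
are eventually bounded below by a positive number at each point outside `K`, and at points of `K`
their upper limit is at most `0`. Since the complement of `K` is dense, a limit of the `u n` would
be a nonnegative harmonic function with a zero at the centre and positive values elsewhere,
contrary to the minimum principle. `exists_not_eventually_re_le_center` is a quantitative form of
this contradiction.
-/

open Filter Metric Set
open scoped Topology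

/-! ### Holomorphic functions on a disc -/

/-- A nowhere vanishing holomorphic function on a disc has a holomorphic logarithm: a primitive
of its logarithmic derivative, normalised at the centre. -/
theorem exists_exp_eqOn_ball {f : ℂ → ℂ} {c : ℂ} {r : ℝ}
    (hf : DifferentiableOn ℂ f (ball c r)) (h0 : ∀ z ∈ ball c r, f z ≠ 0) :
    ∃ L : ℂ → ℂ, DifferentiableOn ℂ L (ball c r) ∧ ∀ z ∈ ball c r, Complex.exp (L z) = f z := by
  rcases (ball c r).eq_empty_or_nonempty with he | hne
  · exact ⟨0, by simp [he], by simp [he]⟩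
  have hr : 0 < r := nonempty_ball.1 hne
  have hc : c ∈ ball c r := mem_ball_self hr
  have hf' : DifferentiableOn ℂ (deriv f) (ball c r) := hf.deriv isOpen_ball
  obtain ⟨g, hg⟩ := (hf'.div hf h0).isExactOn_ball
  have hd : ∀ z ∈ ball c r, HasDerivAt f (deriv f z) z := fun z hz =>
    (hf.differentiableAt (isOpen_ball.mem_nhds hz)).hasDerivAt
  -- `f * exp (-g)` has derivative zero.
  have hq : ∀ z ∈ ball c r, HasDerivAt (fun z => f z * Complex.exp (-g z)) 0 z := by
    intro z hz
    refine ((hd z hz).mul (hg z hz).neg.cexp).congr_deriv ?_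
    have h := h0 z hz
    rw [Pi.div_apply]
    field_simp
    ring
  have hconst : ∀ z ∈ ball c r, f z * Complex.exp (-g z) = f c * Complex.exp (-g c) := by
    intro z hz
    refine (convex_ball c r).is_const_of_fderivWithin_eq_zero (𝕜 := ℂ)
      (f := fun z => f z * Complex.exp (-g z))
      (fun w hw => (hq w hw).differentiableAt.differentiableWithinAt) (fun w hw => ?_) hz hc
    have := (hq w hw).hasFDerivAt.hasFDerivWithinAt (s := ball c r)
    rw [this.fderivWithin (isOpen_ball.uniqueDiffWithinAt hw)]
    ext; simp
  refine ⟨fun z => g z + (Complex.log (f c) - g c), ?_, fun z hz => ?_⟩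
  · exact (fun w hw => ((hg w hw).add_const _).differentiableAt.differentiableWithinAt)
  · have h1 := hconst z hz
    rw [Complex.exp_add, Complex.exp_sub, Complex.exp_log (h0 c hc)]
    rw [Complex.exp_neg, Complex.exp_neg] at h1
    have e1 := Complex.exp_ne_zero (g z)
    have e2 := Complex.exp_ne_zero (g c)
    field_simp at h1 ⊢
    linear_combination -h1

/-- If the real parts of holomorphic functions `L n` on a disc are uniformly bounded above, and at
each point of a dense set they are eventually bounded below by a positive number, then their upper
limit at the centre is positive. In the language of normal families: a limit of `re (L n)` is a
nonnegative harmonic function, it is not identically zero, and so it does not vanish at the centre.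
Neither compactness of the family nor a limit function is needed, as the Schwarz lemma makes the
lower bound locally uniform and the Borel–Carathéodory theorem replaces Harnack's inequality. -/
theorem exists_not_eventually_re_le_center {L : ℕ → ℂ → ℂ} {c : ℂ} {r M : ℝ} {D : Set ℂ}
    (hr : 0 < r) (hL : ∀ n, DifferentiableOn ℂ (L n) (ball c r))
    (hM : ∀ n, ∀ z ∈ ball c r, (L n z).re ≤ M)
    (hD : Dense D) (hpos : ∀ z ∈ D ∩ ball c r, ∃ η > 0, ∀ᶠ n in atTop, η ≤ (L n z).re) :
    ∃ ε > 0, ¬ ∀ᶠ n in atTop, (L n c).re ≤ ε := by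
  by_contra! hc
  have hsub : ∀ z ∈ closedBall c (r / 2), ball z (r / 2) ⊆ ball c r := fun z hz =>
    ball_subset_ball' (by rw [mem_closedBall] at hz; linarith)
  obtain ⟨z₁, hz₁, hz₁D⟩ := hD.inter_open_nonempty (ball c (r / 4)) isOpen_ball
    ⟨c, mem_ball_self (by positivity)⟩
  obtain ⟨η, hη, hηn⟩ := hpos z₁ ⟨hz₁D, ball_subset_ball (by linarith) hz₁⟩
  obtain ⟨ε, hε, hεη⟩ : ∃ ε > 0, 6 * ε = η := ⟨η / 6, by positivity, by ring⟩
  have hlt : Real.exp (-ε) < 1 := by simpa using hε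
  -- The moduli `‖exp (L n z)‖` are equi-Lipschitz on the half disc, by the Schwarz lemma.
  have hlip : ∀ n, ∀ z ∈ closedBall c (r / 2), ∀ w ∈ ball z (r / 2),
      Real.exp (L n w).re - 2 * Real.exp M / (r / 2) * dist w z ≤ Real.exp (L n z).re := by
    intro n z hz w hw
    have hb : ∀ u ∈ ball c r, ‖Complex.exp (L n u)‖ ≤ Real.exp M := fun u hu => by
      rw [Complex.norm_exp]; exact Real.exp_le_exp.2 (hM n u hu)
    have hzc : z ∈ ball c r := hsub z hz (mem_ball_self (by positivity))
    have h := Complex.dist_le_div_mul_dist_of_mapsTo_ball (f := fun u => Complex.exp (L n u))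
      (R₂ := 2 * Real.exp M) ((hL n).mono (hsub z hz)).cexp (fun u hu => by
        rw [mem_closedBall, dist_eq_norm]
        have h1 := hb u (hsub z hz hu)
        have h2 := hb z hzc
        exact (norm_sub_le _ _).trans (by linarith)) hw
    have h3 := norm_sub_norm_le (Complex.exp (L n w)) (Complex.exp (L n z))
    rw [dist_eq_norm] at h
    rw [Complex.norm_exp, Complex.norm_exp] at h3
    linarith
  obtain ⟨δ, hδ, hδr, hδε⟩ : ∃ δ > 0, δ ≤ r / 2 ∧
      2 * Real.exp M / (r / 2) * δ ≤ 1 - Real.exp (-ε) := by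
    have hC : 0 < 2 * Real.exp M / (r / 2) := by positivity
    refine ⟨min (r / 2) ((1 - Real.exp (-ε)) / (2 * Real.exp M / (r / 2))),
      lt_min (by positivity) (div_pos (by linarith) hC), min_le_left _ _, ?_⟩
    rw [mul_comm, ← le_div_iff₀ hC]
    exact min_le_right _ _
  -- A finite `δ`-net of points of `D` turns the pointwise lower bounds into a uniform one.
  obtain ⟨T, hTD, hT⟩ := (isCompact_closedBall c (r / 2)).elim_finite_subcover_image
    (b := D ∩ ball c r) (c := fun d => ball d δ) (fun _ _ => isOpen_ball) (fun z hz => by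
      obtain ⟨d, hdz, hd⟩ := hD.inter_open_nonempty (ball z δ) isOpen_ball
        ⟨z, mem_ball_self hδ⟩
      exact mem_biUnion (x := d) ⟨hd, hsub z hz (ball_subset_ball hδr hdz)⟩
        (mem_ball_comm.1 hdz))
  have hev : ∀ᶠ n in atTop, ∀ d ∈ T, 0 ≤ (L n d).re := by
    refine (hT.1.eventually_all).2 fun d hd => ?_
    obtain ⟨η', h0, h⟩ := hpos d (hTD hd)
    exact h.mono fun n hn => h0.le.trans hn
  obtain ⟨n, hnT, hn₁, hnc⟩ := (hev.and (hηn.and (hc ε hε))).exists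
  have hlow : ∀ z ∈ closedBall c (r / 2), -ε ≤ (L n z).re := by
    intro z hz
    obtain ⟨d, hdT, hd⟩ := mem_iUnion₂.1 (hT.2 hz)
    rw [mem_ball_comm] at hd
    have h1 := hlip n z hz d (ball_subset_ball hδr hd)
    have h2 : 1 ≤ Real.exp (L n d).re := Real.one_le_exp (hnT d hdT)
    have h3 : 2 * Real.exp M / (r / 2) * dist d z ≤ 2 * Real.exp M / (r / 2) * δ := by
      gcongr; exact (mem_ball.1 hd).le
    exact Real.exp_le_exp.1 (by linarith)
  have hmem : ∀ w ∈ ball (0 : ℂ) (r / 2), c + w ∈ ball c (r / 2) := fun w hw => by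
    simpa using hw
  have hz₁' : ‖z₁ - c‖ < r / 4 := by simpa [dist_eq_norm] using hz₁
  -- `re (L n)` is at least `-ε` on the half disc and at most `ε` at its centre, which bounds its
  -- variation at `z₁`.
  have hbc := Complex.borelCaratheodory_zero (f := fun w => L n c - L n (c + w)) (M := 2 * ε)
    (R := r / 2) (z := z₁ - c) (by positivity)
    (by
      refine (differentiableOn_const _).sub (((hL n).comp (t := ball c r) (s := ball 0 (r / 2))
        (f := fun w => c + w) (by fun_prop) fun w hw => ?_))
      exact ball_subset_ball (by linarith) (hmem w hw))
    (fun w hw => by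
      have := hlow _ (ball_subset_closedBall (hmem w hw))
      simp only [mem_ofPred_eq, Complex.sub_re]
      linarith)
    (by positivity) (by rw [mem_ball_zero_iff]; linarith) (by simp)
  have h4 : 2 * (2 * ε) * ‖z₁ - c‖ / (r / 2 - ‖z₁ - c‖) ≤ 4 * ε := by
    rw [div_le_iff₀ (by linarith)]
    nlinarith
  have h5 := Complex.abs_re_le_norm (L n c - L n (c + (z₁ - c)))
  rw [add_sub_cancel] at h5 hbc
  rw [Complex.sub_re] at h5
  have h6 := (abs_le.1 (h5.trans (hbc.trans h4))).1
  linarith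

/-! ### Quadratic dynamics in the complex plane -/

/-- The quadratic polynomial `z ↦ z ^ 2 + a` of the complex plane. -/
def complexQuadMap (a z : ℂ) : ℂ := z ^ 2 + a

/-- The filled-in Julia set of `z ↦ z ^ 2 + a`, with boundedness of the forward orbit written as
an explicit bound on the moduli. -/
def complexFilledJulia (a : ℂ) : Set ℂ := {z | ∃ C : ℝ, ∀ n : ℕ, ‖(complexQuadMap a)^[n] z‖ ≤ C}

theorem differentiable_complexQuadMap_iterate (a : ℂ) (n : ℕ) :
    Differentiable ℂ (complexQuadMap a)^[n] := by
  have h : Differentiable ℂ (complexQuadMap a) := by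
    unfold complexQuadMap; fun_prop
  exact h.iterate n

/-- Orbits grow at most doubly exponentially, locally uniformly in the starting point: with
`1 + ‖a‖ ≤ s`, the quantity `‖z‖ + s` is at most squared by each step. -/
theorem norm_complexQuadMap_iterate_add_le {a : ℂ} {s : ℝ} (hs : 1 + ‖a‖ ≤ s) (z : ℂ) (n : ℕ) :
    ‖(complexQuadMap a)^[n] z‖ + s ≤ (‖z‖ + s) ^ 2 ^ n := by
  induction n with
  | zero => simp
  | succ n ih =>
    rw [Function.iterate_succ_apply', pow_succ, pow_mul]
    set w := (complexQuadMap a)^[n] z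
    have h1 : ‖complexQuadMap a w‖ ≤ ‖w‖ ^ 2 + ‖a‖ :=
      (norm_add_le (w ^ 2) a).trans_eq (by rw [norm_pow])
    have h2 : (‖w‖ + s) ^ 2 ≤ ((‖z‖ + s) ^ 2 ^ n) ^ 2 := by
      have : 0 ≤ ‖w‖ + s := by linarith [norm_nonneg a, norm_nonneg w]
      gcongr
    nlinarith [norm_nonneg a, norm_nonneg w]

/-- Beyond the radius `s + 2`, orbits escape at least doubly exponentially, because there the
quantity `‖w‖ - s` is at least squared by each step. -/
theorem two_pow_le_norm_complexQuadMap_iterate_sub {a : ℂ} {s : ℝ} (hs : 1 + ‖a‖ ≤ s) {w : ℂ}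
    (hw : s + 2 ≤ ‖w‖) (k : ℕ) : (2 : ℝ) ^ 2 ^ k ≤ ‖(complexQuadMap a)^[k] w‖ - s := by
  induction k with
  | zero => simp; linarith
  | succ k ih =>
    rw [Function.iterate_succ_apply', pow_succ, pow_mul]
    set v := (complexQuadMap a)^[k] w
    have h1 : ‖v‖ ^ 2 - ‖a‖ ≤ ‖complexQuadMap a v‖ := by
      have := norm_sub_norm_le (v ^ 2) (-a)
      simpa [complexQuadMap] using this
    have h3 : (1 : ℝ) ≤ 2 ^ 2 ^ k := one_le_pow₀ (by norm_num)
    have h2 : ((2 : ℝ) ^ 2 ^ k) ^ 2 ≤ (‖v‖ - s) ^ 2 := by gcongr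
    nlinarith [norm_nonneg a]

/-- Escaping points have a positive escape rate: `2 ^ (-n) * log ‖Qⁿ(z) - p‖` is eventually bounded
below by a positive number. -/
theorem exists_log_growth_of_notMem {a p z : ℂ} (hz : z ∉ complexFilledJulia a) :
    ∃ η > 0, ∀ᶠ n : ℕ in atTop, η * 2 ^ n ≤ Real.log ‖(complexQuadMap a)^[n] z - p‖ := by
  set s : ℝ := 1 + ‖a‖ + ‖p‖
  have hs : 1 + ‖a‖ ≤ s := by simp [s]
  have hp : ‖p‖ ≤ s := by have := norm_nonneg a; simp only [s]; linarith
  obtain ⟨m, hm⟩ : ∃ m, s + 2 < ‖(complexQuadMap a)^[m] z‖ := by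
    by_contra! h
    exact hz ⟨_, h⟩
  refine ⟨Real.log 2 / 2 ^ m, by positivity, ?_⟩
  filter_upwards [eventually_ge_atTop m] with n hn
  obtain ⟨k, rfl⟩ := Nat.exists_eq_add_of_le' hn
  have h1 := two_pow_le_norm_complexQuadMap_iterate_sub hs hm.le k
  rw [← Function.iterate_add_apply] at h1
  have h2 := norm_sub_norm_le ((complexQuadMap a)^[k + m] z) p
  have h3 := Real.log_le_log (by positivity)
    (h1.trans (show _ ≤ ‖(complexQuadMap a)^[k + m] z - p‖ by linarith))
  rw [Real.log_pow] at h3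
  push_cast at h3
  calc Real.log 2 / 2 ^ m * 2 ^ (k + m) = 2 ^ k * Real.log 2 := by rw [pow_add]; field_simp
    _ ≤ _ := h3

/-- If a filled-in Julia set has dense complement, it lies in the closure of every backward orbit.
If a disc about `c` in the filled-in Julia set missed the backward orbit of `p`, the functions
`2 ^ (-n) * log (Qⁿ(z) - p)` would be holomorphic on that disc, with real parts bounded above,
eventually positive at the escaping points, and with upper limit at most `0` at `c`. -/
theorem complexFilledJulia_subset_closure_preimages {a p : ℂ}
    (hD : Dense (complexFilledJulia a)ᶜ) :
    complexFilledJulia a ⊆ closure (⋃ k : ℕ, {z | (complexQuadMap a)^[k] z = p}) := by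
  intro c hc
  by_contra hcl
  obtain ⟨r, hr, hball⟩ := Metric.isOpen_iff.1 isClosed_closure.isOpen_compl c hcl
  have hne : ∀ n, ∀ z ∈ ball c r, (complexQuadMap a)^[n] z - p ≠ 0 := fun n z hz h =>
    hball hz (subset_closure (mem_iUnion.2 ⟨n, sub_eq_zero.1 h⟩))
  choose G hG hexp using fun n => exists_exp_eqOn_ball
    ((differentiable_complexQuadMap_iterate a n).sub_const p).differentiableOn (hne n)
  have hre : ∀ n, ∀ z ∈ ball c r, (G n z).re = Real.log ‖(complexQuadMap a)^[n] z - p‖ := by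
    intro n z hz
    rw [← hexp n z hz, Complex.norm_exp, Real.log_exp]
  have hLre : ∀ n z, ((2 ^ n : ℂ)⁻¹ * G n z).re = (2 ^ n : ℝ)⁻¹ * (G n z).re := by
    intro n z
    rw [show (2 ^ n : ℂ)⁻¹ = (((2 ^ n : ℝ)⁻¹ : ℝ) : ℂ) by push_cast; rfl, Complex.re_ofReal_mul]
  set s : ℝ := 1 + ‖a‖ + ‖p‖
  have hs : 1 + ‖a‖ ≤ s := by simp [s]
  have hp : ‖p‖ ≤ s := by have := norm_nonneg a; simp only [s]; linarith
  obtain ⟨C, hC⟩ := hc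
  have hcb : c ∈ ball c r := mem_ball_self hr
  obtain ⟨ε, hε, hnot⟩ := exists_not_eventually_re_le_center
    (L := fun n z => (2 ^ n : ℂ)⁻¹ * G n z) (c := c) (M := Real.log (‖c‖ + r + s)) hr (fun n => (hG n).const_mul _)
    (fun n z hz => by
      have h1 := norm_complexQuadMap_iterate_add_le hs z n
      have h2 : ‖(complexQuadMap a)^[n] z - p‖ ≤ (‖z‖ + s) ^ 2 ^ n :=
        (norm_sub_le _ _).trans (by linarith)
      have h3 := Real.log_le_log (norm_pos_iff.2 (hne n z hz)) h2
      have h4 : ‖z‖ ≤ ‖c‖ + r := by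
        have := norm_le_norm_add_norm_sub' z c
        have := mem_ball_iff_norm.1 hz
        linarith
      have h5 : 0 < ‖z‖ + s := by linarith [norm_nonneg a, norm_nonneg z]
      have h6 : Real.log (‖z‖ + s) ≤ Real.log (‖c‖ + r + s) :=
        Real.log_le_log h5 (by linarith)
      rw [Real.log_pow] at h3
      push_cast at h3
      rw [hLre, hre n z hz, inv_mul_le_iff₀ (by positivity)]
      exact h3.trans (by gcongr))
    hD
    (fun z hz => by
      obtain ⟨η, hη, hev⟩ := exists_log_growth_of_notMem (p := p) hz.1
      refine ⟨η, hη, hev.mono fun n hn => ?_⟩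
      rw [hLre, hre n z hz.2, le_inv_mul_iff₀ (by positivity), mul_comm]
      exact hn)
  refine hnot ?_
  -- The orbit of `c` is bounded, so the factor `2 ^ (-n)` removes any contribution above `0`.
  have hlim : Tendsto (fun n : ℕ => (2 ^ n : ℝ)⁻¹ * Real.log (C + ‖p‖)) atTop (𝓝 0) := by
    simpa using (tendsto_inv_atTop_zero.comp
      (tendsto_pow_atTop_atTop_of_one_lt (one_lt_two (α := ℝ)))).mul_const (Real.log (C + ‖p‖))
  filter_upwards [hlim.eventually_le_const hε] with n hn
  rw [hLre, hre n c hcb]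
  refine le_trans ?_ hn
  gcongr
  · exact norm_pos_iff.2 (hne n c hcb)
  · exact (norm_sub_le _ _).trans (by linarith [hC n])

/-- The preimages of a fixed point under the iterates of a map increase with the number of
iterations. -/
theorem Function.IsFixedPt.iterate_eq_of_le {α : Type*} {f : α → α} {p z : α}
    (hp : Function.IsFixedPt f p) {k n : ℕ} (hkn : k ≤ n) (hz : f^[k] z = p) : f^[n] z = p := by
  obtain ⟨m, rfl⟩ := Nat.exists_eq_add_of_le' hkn
  rw [Function.iterate_add_apply, hz]
  exact hp.iterate m

/-! ### Idempotent components of bicomplex numbers -/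

namespace Bicomplex

/-- The point of the bicomplex plane with idempotent components `p.1` and `p.2`. -/
noncomputable def ofComponents (p : ℂ × ℂ) : Bicomplex := p.1 • e₁ + p.2 • e₂

/-- The coefficient `z₁ - z₂ i₁` of `e₁` in the idempotent representation of `z₁ + z₂ i₂`. -/
noncomputable def fstComponent (w : Bicomplex) : ℂ := w.re - w.im * Complex.I

/-- The coefficient `z₁ + z₂ i₁` of `e₂` in the idempotent representation of `z₁ + z₂ i₂`. -/
noncomputable def sndComponent (w : Bicomplex) : ℂ := w.re + w.im * Complex.I

theorem ofComponents_re (p : ℂ × ℂ) : (ofComponents p).re = (p.1 + p.2) / 2 := by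
  simp [ofComponents, e₁, e₂, j, i₂, QuadraticAlgebra.re_one]; ring

theorem ofComponents_im (p : ℂ × ℂ) : (ofComponents p).im = (p.1 - p.2) / 2 * Complex.I := by
  simp [ofComponents, e₁, e₂, j, i₂, QuadraticAlgebra.im_one]; ring

@[simp]
theorem fstComponent_ofComponents (p : ℂ × ℂ) : fstComponent (ofComponents p) = p.1 := by
  rw [fstComponent, ofComponents_re, ofComponents_im]
  linear_combination -(p.1 - p.2) / 2 * Complex.I_sq

@[simp]
theorem sndComponent_ofComponents (p : ℂ × ℂ) : sndComponent (ofComponents p) = p.2 := by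
  rw [sndComponent, ofComponents_re, ofComponents_im]
  linear_combination (p.1 - p.2) / 2 * Complex.I_sq

theorem ofComponents_components (w : Bicomplex) :
    ofComponents (fstComponent w, sndComponent w) = w := by
  ext
  · rw [ofComponents_re]; simp only [fstComponent, sndComponent]; ring
  · rw [ofComponents_im]; simp only [fstComponent, sndComponent]
    linear_combination -w.im * Complex.I_sq

theorem continuous_ofComponents : Continuous ofComponents := by
  have hind : Topology.IsInducing toC2 := ⟨rfl⟩
  rw [hind.continuous_iff]
  have h : toC2 ∘ ofComponents =
      fun p => WithLp.toLp 2 ((p.1 + p.2) / 2, (p.1 - p.2) / 2 * Complex.I) := by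
    funext p
    show WithLp.toLp 2 ((ofComponents p).re, (ofComponents p).im) = _
    rw [ofComponents_re, ofComponents_im]
  rw [h]
  exact (WithLp.prod_continuous_toLp 2 ℂ ℂ).comp (by fun_prop)

theorem norm_re_le (w : Bicomplex) : ‖w.re‖ ≤ ‖w‖ := by
  rw [norm_eq]; exact Real.le_sqrt_of_sq_le (by nlinarith [sq_nonneg ‖w.im‖])

theorem norm_im_le (w : Bicomplex) : ‖w.im‖ ≤ ‖w‖ := by
  rw [norm_eq]; exact Real.le_sqrt_of_sq_le (by nlinarith [sq_nonneg ‖w.re‖])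

theorem norm_fstComponent_le (w : Bicomplex) : ‖fstComponent w‖ ≤ 2 * ‖w‖ := by
  have h := norm_sub_le w.re (w.im * Complex.I)
  rw [norm_mul, Complex.norm_I, mul_one] at h
  rw [fstComponent]
  linarith [norm_re_le w, norm_im_le w]

theorem norm_sndComponent_le (w : Bicomplex) : ‖sndComponent w‖ ≤ 2 * ‖w‖ := by
  have h := norm_add_le w.re (w.im * Complex.I)
  rw [norm_mul, Complex.norm_I, mul_one] at h
  rw [sndComponent]
  linarith [norm_re_le w, norm_im_le w]

theorem norm_le_norm_components (w : Bicomplex) :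
    ‖w‖ ≤ ‖fstComponent w‖ + ‖sndComponent w‖ := by
  have h1 : ‖w.re‖ ≤ (‖fstComponent w‖ + ‖sndComponent w‖) / 2 := by
    have : w.re = (fstComponent w + sndComponent w) / 2 := by
      simp only [fstComponent, sndComponent]; ring
    rw [this, norm_div, Complex.norm_ofNat]
    gcongr; exact norm_add_le _ _
  have h2 : ‖w.im‖ ≤ (‖fstComponent w‖ + ‖sndComponent w‖) / 2 := by
    have : w.im = (fstComponent w - sndComponent w) / 2 * Complex.I := by
      simp only [fstComponent, sndComponent]
      linear_combination w.im * Complex.I_sq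
    rw [this, norm_mul, Complex.norm_I, mul_one, norm_div, Complex.norm_ofNat]
    gcongr; exact norm_sub_le _ _
  rw [norm_eq]
  refine Real.sqrt_le_iff.2 ⟨by positivity, ?_⟩
  nlinarith [norm_nonneg w.re, norm_nonneg w.im]

theorem fstComponent_quadMap (c w : Bicomplex) :
    fstComponent (quadMap c w) = complexQuadMap (fstComponent c) (fstComponent w) := by
  simp only [quadMap, complexQuadMap, fstComponent, pow_two, QuadraticAlgebra.re_add,
    QuadraticAlgebra.im_add, QuadraticAlgebra.re_mul, QuadraticAlgebra.im_mul]
  linear_combination -w.im ^ 2 * Complex.I_sq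

theorem sndComponent_quadMap (c w : Bicomplex) :
    sndComponent (quadMap c w) = complexQuadMap (sndComponent c) (sndComponent w) := by
  simp only [quadMap, complexQuadMap, sndComponent, pow_two, QuadraticAlgebra.re_add,
    QuadraticAlgebra.im_add, QuadraticAlgebra.re_mul, QuadraticAlgebra.im_mul]
  linear_combination -w.im ^ 2 * Complex.I_sq

theorem fstComponent_quadMap_iterate (c w : Bicomplex) (n : ℕ) :
    fstComponent ((quadMap c)^[n] w) = (complexQuadMap (fstComponent c))^[n] (fstComponent w) :=
  (show Function.Semiconj fstComponent _ _ from fstComponent_quadMap c).iterate_right n w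

theorem sndComponent_quadMap_iterate (c w : Bicomplex) (n : ℕ) :
    sndComponent ((quadMap c)^[n] w) = (complexQuadMap (sndComponent c))^[n] (sndComponent w) :=
  (show Function.Semiconj sndComponent _ _ from sndComponent_quadMap c).iterate_right n w

/-- The filled-in Julia set of `P_c` is the bicomplex cartesian product of the filled-in Julia sets
of the quadratic polynomials that `P_c` induces on the idempotent components. -/
theorem mem_filledJulia_iff {c w : Bicomplex} :
    w ∈ filledJulia c ↔ fstComponent w ∈ complexFilledJulia (fstComponent c) ∧
      sndComponent w ∈ complexFilledJulia (sndComponent c) := by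
  simp only [filledJulia, complexFilledJulia, mem_ofPred_eq, isBounded_iff_forall_norm_le,
    forall_mem_range, ← fstComponent_quadMap_iterate, ← sndComponent_quadMap_iterate]
  constructor
  · rintro ⟨C, hC⟩
    exact ⟨⟨2 * C, fun n => (norm_fstComponent_le _).trans (by linarith [hC n])⟩,
      ⟨2 * C, fun n => (norm_sndComponent_le _).trans (by linarith [hC n])⟩⟩
  · rintro ⟨⟨C, hC⟩, ⟨C', hC'⟩⟩
    exact ⟨C + C', fun n => (norm_le_norm_components _).trans (add_le_add (hC n) (hC' n))⟩

/-! ### Filled-in Julia sets that are bicomplex dendrites -/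

theorem cartesian_eq_image (X₁ X₂ : Set ℂ) : cartesian X₁ X₂ = ofComponents '' (X₁ ×ˢ X₂) := by
  ext w
  constructor
  · rintro ⟨x, hx, y, hy, rfl⟩
    exact ⟨(x, y), ⟨hx, hy⟩, rfl⟩
  · rintro ⟨⟨x, y⟩, ⟨hx, hy⟩, rfl⟩
    exact ⟨x, hx, y, hy, rfl⟩

theorem components_mem_of_mem_cartesian {X₁ X₂ : Set ℂ} {w : Bicomplex}
    (hw : w ∈ cartesian X₁ X₂) : fstComponent w ∈ X₁ ∧ sndComponent w ∈ X₂ := by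
  rw [cartesian_eq_image] at hw
  obtain ⟨p, hp, rfl⟩ := hw
  simpa using hp

theorem dense_compl_of_isNowhereDense {X Y : Set ℂ} (hX : IsNowhereDense X) (hYX : Y ⊆ X) :
    Dense Yᶜ :=
  interior_eq_empty_iff_dense_compl.1
    (subset_empty_iff.1 ((interior_mono (hYX.trans subset_closure)).trans_eq hX))

/-- The factors of a nonempty bicomplex cartesian set are determined by it, so the planar
filled-in Julia sets inherit nowhere density from the given dendrites. -/
theorem dense_compl_complexFilledJulia {c : Bicomplex}
    (hc : IsBicomplexDendrite (filledJulia c)) {w : Bicomplex} (hw : w ∈ filledJulia c) :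
    Dense (complexFilledJulia (fstComponent c))ᶜ ∧
      Dense (complexFilledJulia (sndComponent c))ᶜ := by
  obtain ⟨X₁, X₂, h₁, h₂, hX⟩ := hc
  have hw' := mem_filledJulia_iff.1 hw
  refine ⟨dense_compl_of_isNowhereDense h₁.isNowhereDense fun x hx => ?_,
    dense_compl_of_isNowhereDense h₂.isNowhereDense fun y hy => ?_⟩
  · have h : ofComponents (x, sndComponent w) ∈ filledJulia c :=
      mem_filledJulia_iff.2 (by simpa using ⟨hx, hw'.2⟩)
    rw [hX] at h
    simpa using (components_mem_of_mem_cartesian h).1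
  · have h : ofComponents (fstComponent w, y) ∈ filledJulia c :=
      mem_filledJulia_iff.2 (by simpa using ⟨hw'.1, hy⟩)
    rw [hX] at h
    simpa using (components_mem_of_mem_cartesian h).2

theorem isClosed_filledJulia {c : Bicomplex} (hc : IsBicomplexDendrite (filledJulia c)) :
    IsClosed (filledJulia c) := by
  obtain ⟨X₁, X₂, h₁, h₂, hX⟩ := hc
  rw [hX, cartesian_eq_image]
  exact ((h₁.isCompact.prod h₂.isCompact).image continuous_ofComponents).isClosed

theorem julia_eq_filledJulia {c : Bicomplex} (hc : IsBicomplexDendrite (filledJulia c)) :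
    julia c = filledJulia c := by
  rw [julia, (isClosed_filledJulia hc).frontier_eq]
  suffices h : interior (filledJulia c) = ∅ by rw [h, sdiff_empty]
  refine eq_empty_of_forall_notMem fun w hw => ?_
  -- The slice of the interior through `w` along `e₁` is open in the plane.
  have hopen : IsOpen ((fun x => ofComponents (x, sndComponent w)) ⁻¹' interior (filledJulia c)) :=
    isOpen_interior.preimage (continuous_ofComponents.comp (by fun_prop))
  have hD := (dense_compl_complexFilledJulia hc (interior_subset hw)).1
  obtain ⟨x, hx, hx'⟩ := hD.inter_open_nonempty _ hopen
    ⟨fstComponent w, by simpa [ofComponents_components] using hw⟩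
  exact hx' (by simpa using (mem_filledJulia_iff.1 (interior_subset hx)).1)

theorem mem_filledJulia_of_iterate_eq {c v w : Bicomplex} {k : ℕ}
    (hw : Function.IsFixedPt (quadMap c) w) (hv : (quadMap c)^[k] v = w) : v ∈ filledJulia c := by
  refine (((finite_Iio k).image fun n => (quadMap c)^[n] v).insert w).isBounded.subset ?_
  rintro _ ⟨n, rfl⟩
  rcases lt_or_ge n k with h | h
  · exact Or.inr ⟨n, h, rfl⟩
  · exact Or.inl (hw.iterate_eq_of_le h hv)

end Bicomplex

open Bicomplex in
theorem mainTheorem2 (c : Bicomplex) (hc : IsBicomplexDendrite (Bicomplex.filledJulia c))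
    (w₁ : Bicomplex) (hfix : Function.IsFixedPt (Bicomplex.quadMap c) w₁)
    (hw₁ : w₁ ∈ Bicomplex.julia c) :
    (⋃ k : ℕ, ⋃ _ : 1 ≤ k, Bicomplex.inverseIterate c k w₁) ⊆ Bicomplex.julia c ∧
      Bicomplex.julia c ⊆ closure (⋃ k : ℕ, ⋃ _ : 1 ≤ k, Bicomplex.inverseIterate c k w₁) := by
  rw [julia_eq_filledJulia hc] at hw₁ ⊢
  refine ⟨iUnion₂_subset fun k _ v hv => mem_filledJulia_of_iterate_eq hfix hv, fun v hv => ?_⟩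
  obtain ⟨hD₁, hD₂⟩ := dense_compl_complexFilledJulia hc hw₁
  obtain ⟨hv₁, hv₂⟩ := mem_filledJulia_iff.1 hv
  have h₁ := complexFilledJulia_subset_closure_preimages (p := fstComponent w₁) hD₁ hv₁
  have h₂ := complexFilledJulia_subset_closure_preimages (p := sndComponent w₁) hD₂ hv₂
  have hfix₁ : Function.IsFixedPt (complexQuadMap (fstComponent c)) (fstComponent w₁) :=
    (fstComponent_quadMap c w₁).symm.trans (congrArg _ hfix)
  have hfix₂ : Function.IsFixedPt (complexQuadMap (sndComponent c)) (sndComponent w₁) :=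
    (sndComponent_quadMap c w₁).symm.trans (congrArg _ hfix)
  have hmem := closure_prod_eq.symm.subset (mk_mem_prod h₁ h₂)
  have himage := image_closure_subset_closure_image continuous_ofComponents
    (mem_image_of_mem ofComponents hmem)
  rw [ofComponents_components] at himage
  refine closure_mono ?_ himage
  rintro _ ⟨⟨x, y⟩, ⟨hx, hy⟩, rfl⟩
  obtain ⟨k, hk⟩ := mem_iUnion.1 hx
  obtain ⟨l, hl⟩ := mem_iUnion.1 hy
  -- Preimages of a fixed point under lower iterates are preimages under higher ones, so one
  -- exponent serves both components.
  refine mem_iUnion₂.2 ⟨k + l + 1, by omega, ?_⟩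
  show (quadMap c)^[k + l + 1] _ = w₁
  rw [← ofComponents_components ((quadMap c)^[k + l + 1] _), fstComponent_quadMap_iterate,
    sndComponent_quadMap_iterate, fstComponent_ofComponents, sndComponent_ofComponents,
    hfix₁.iterate_eq_of_le (by omega) hk, hfix₂.iterate_eq_of_le (by omega) hl,
    ofComponents_components]
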